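/- **The map.** Let $T\colon[0,1]\to[0,1]$ be of class $C^4$ with $T(0)=T(1)=0$, strictly increasing on $[0,c)$ and strictly decreasing on $(c,1]$ for some $c\in(0,1)$, with $T'(c)=0$, $T''(c)\neq0$ and $\Delta:=T(c)<1$. Put $\Gamma:=1-\Delta$, and extend $T$ to $I:=[-\Gamma,1]$ so that it is continuous at $0$ and on $[-\Gamma,0)$ is $C^4$, positive and decreasing, with $T(-\Gamma)<\Delta$. * $T$ is *periodic* if it has a globally attracting cycle (possibly a fixed point), that is, a periodic orbit $\mathcal O\subset[0,1]$ such that $\operatorname{dist}(T^n(x),\mathcal O)\to0$ for Lebesgue-almost every $x\in[0,1]$. * $T$ is *chaotic* if its Schwarzian derivative $\frac{T'''}{T'}-\frac32\bigl(\frac{T''}{T'}\bigr)^2$ is negative on $(0,1)\setminus\{c\}$ (in particular $T'\ne0$ there), there are constants $k_0\ge1$, $1<\lambda_c<2$ and $\alpha>0$ with $e^{2\alpha}<\sqrt{\lambda_c}$ such that $|T^k(c)-c|\ge e^{-\alpha k}$ and $|(T^k)'(\Delta)|\ge\lambda_c^k$ for all $k\ge k_0$, and $T$ is topologically transitive on $[T(\Delta),\Delta]$: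 for all nonempty relatively open $U,V\subset[T(\Delta),\Delta]$ there is $n\ge 0$ with $T^{-n}U\cap V\neq\emptyset$. **The noise.** Let $s\colon I\to[0,\Gamma/2)$ vanish on $[-\Gamma,0]$ and be continuous on $(0,1)$, with $s(x)>0$ for $x\in(0,1)$, $T(x)-s(x)>0$ for $x\in(0,1-\Gamma/2]$, and $T(x)-s(x)>x$ for all sufficiently small $x>0$. For each $x\in I$ with $s(x)>0$ let $g_x$ be a probability density on $\mathbb R$, jointly measurable in $(x,y)$, whose support (that of the measure $g_x(y)\,dy$) is $[-s(x),s(x)]$, and suppose that $\sup_{x\in[\varepsilon,1-\varepsilon]}|g_x|_{TV}<\infty$ for every $\varepsilon>0$, where $|\cdot|_{TV}$ is the total variation on $\mathbb R$. Consider the Markov chain on $I$ whose transition probability $P_x$ is the law of $T(x)+Y$ with $Y\sim g_x$ if $s(x)>0$, and $P_x=\delta_{T(x)}$ if $s(x)=0$. A probability measure $\mu$ on $I$ is *stationary* if $\int P_x(A)\,d\mu(x)=\mu(A)$ for all Borel sets $A$. **Theorem.** If $T$ is periodic or chaotic, then the chain admits exactly one stationary probability measure $\mu$ that has a density of bounded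 variation with respect to Lebesgue measure on $I$. Moreover, $\operatorname{supp}\mu$ contains an open neighbourhood of the globally attracting cycle if $T$ is periodic, and it contains the interval $[T(\Delta),\Delta]$ if $T$ is chaotic. -/

import Mathlib

open Set Filter Topology MeasureTheory

noncomputable section

namespace NoisyUnimodal

/-- The Schwarzian derivative `T'''/T' - (3/2) (T''/T')²` of `T` at `x`. -/
def schwarzian (T : ℝ → ℝ) (x : ℝ) : ℝ :=
  iteratedDeriv 3 T x / deriv T x - 3 / 2 * (iteratedDeriv 2 T x / deriv T x) ^ 2

/-- `Γ = 1 - Δ`, where `Δ = T c` is the maximal value of the unimodal map. -/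
def gap (T : ℝ → ℝ) (c : ℝ) : ℝ := 1 - T c

/-- The (extended) state space `[-Γ, 1]`. -/
def stateSpace (T : ℝ → ℝ) (c : ℝ) : Set ℝ := Icc (-gap T c) 1

/-- `T` restricts to a `C⁴` unimodal map of `[0, 1]` into itself which vanishes at both endpoints,
has a nondegenerate (quadratic) critical point at `c`, and has maximal value `T c < 1`. -/
structure IsUnimodal (T : ℝ → ℝ) (c : ℝ) : Prop where
  crit_mem : c ∈ Ioo (0 : ℝ) 1
  mapsTo : MapsTo T (Icc 0 1) (Icc 0 1)
  contDiffOn : ContDiffOn ℝ 4 T (Icc 0 1)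
  map_zero : T 0 = 0
  map_one : T 1 = 0
  strictMonoOn : StrictMonoOn T (Ico 0 c)
  strictAntiOn : StrictAntiOn T (Ioc c 1)
  deriv_crit : deriv T c = 0
  deriv_two_crit : iteratedDeriv 2 T c ≠ 0
  peak_lt_one : T c < 1

/-- `T` is extended to `[-Γ, 0)` in such a way that it is continuous at `0`, and is `C⁴`, positive
and decreasing on `[-Γ, 0)`, with `T (-Γ) < Δ`. -/
structure IsExtended (T : ℝ → ℝ) (c : ℝ) : Prop where
  continuous_zero : ContinuousWithinAt T (Iic 0) 0
  contDiffOn : ContDiffOn ℝ 4 T (Ico (-gap T c) 0)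
  pos : ∀ x ∈ Ico (-gap T c) 0, 0 < T x
  antitoneOn : AntitoneOn T (Ico (-gap T c) 0)
  map_left_lt : T (-gap T c) < T c

/-- `O ⊆ [0, 1]` is a cycle (the orbit of a periodic point, possibly a fixed point) of `T` which
is globally attracting: the orbit of Lebesgue almost every initial condition in `[0, 1]`
converges to `O`. -/
def IsGloballyAttractingCycle (T : ℝ → ℝ) (O : Set ℝ) : Prop :=
  (∃ p ∈ Icc (0 : ℝ) 1, p ∈ Function.periodicPts T ∧ O = range (fun n : ℕ => T^[n] p)) ∧
    ∀ᵐ x ∂(volume.restrict (Icc (0 : ℝ) 1)),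
      Tendsto (fun n : ℕ => Metric.infDist (T^[n] x) O) atTop (𝓝 0)

/-- The map is periodic if it has a globally attracting fixed point or cycle. -/
def IsPeriodic (T : ℝ → ℝ) : Prop := ∃ O, IsGloballyAttractingCycle T O

/-- Topological transitivity on the subspace `X`: for all nonempty relatively open subsets
`U ∩ X`, `V ∩ X` there is `n` such that `T⁻ⁿ (U ∩ X)` meets `V ∩ X`. -/
def IsTransitiveOn (T : ℝ → ℝ) (X : Set ℝ) : Prop :=
  ∀ U V : Set ℝ, IsOpen U → IsOpen V → (U ∩ X).Nonempty → (V ∩ X).Nonempty →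
    ∃ n : ℕ, (T^[n] ⁻¹' (U ∩ X) ∩ (V ∩ X)).Nonempty

/-- The additional properties of a chaotic unimodal map with critical point `c`: negative
Schwarzian derivative off the critical point, slow recurrence of the critical point, exponential
growth of the derivative along the orbit of the critical value, and topological transitivity on
the dynamical core `[T Δ, Δ]`, where `Δ = T c`. -/
structure IsChaotic (T : ℝ → ℝ) (c : ℝ) : Prop where
  schwarzian_neg : ∀ x ∈ Ioo (0 : ℝ) 1, x ≠ c → schwarzian T x < 0
  critical_orbit : ∃ (k₀ : ℕ) (lam α : ℝ), 1 ≤ k₀ ∧ 1 < lam ∧ lam < 2 ∧ 0 < α ∧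
    Real.exp (2 * α) < √lam ∧
    (∀ k : ℕ, k₀ ≤ k → Real.exp (-α * k) ≤ |T^[k] c - c|) ∧
    (∀ k : ℕ, k₀ ≤ k → lam ^ k ≤ |deriv (T^[k]) (T c)|)
  transitive : IsTransitiveOn T (Icc (T (T c)) (T c))

/-- The assumptions on the noise: `g x` is the probability density of the noise at the state `x`,
and the support of this probability measure is `[-s x, s x]`. Where `s x = 0` there is no noise
and `g x` plays no role. -/
structure IsNoise (T : ℝ → ℝ) (c : ℝ) (s : ℝ → ℝ) (g : ℝ → ℝ → ℝ) : Prop where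
  measurable : Measurable (Function.uncurry g)
  size_continuousOn : ContinuousOn s (Ioo 0 1)
  size_pos : ∀ x ∈ Ioo (0 : ℝ) 1, 0 < s x
  size_lt : ∀ x ∈ Ioo (0 : ℝ) 1, s x < gap T c / 2
  size_nonpos : ∀ x ∈ Icc (-gap T c) 0, s x = 0
  size_one : 0 ≤ s 1 ∧ s 1 < gap T c / 2
  pos_of_le : ∀ x ∈ Ioc 0 (1 - gap T c / 2), 0 < T x - s x
  expanding : ∀ᶠ x in 𝓝[>] (0 : ℝ), x < T x - s x
  nonneg : ∀ x ∈ stateSpace T c, 0 < s x → ∀ y, 0 ≤ g x y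
  lintegral_eq_one : ∀ x ∈ stateSpace T c, 0 < s x → ∫⁻ y, ENNReal.ofReal (g x y) = 1
  support_eq : ∀ x ∈ stateSpace T c, 0 < s x →
    (volume.withDensity (fun y => ENNReal.ofReal (g x y))).support = Icc (-s x) (s x)
  variation_lt_top : ∀ ε : ℝ, 0 < ε → ⨆ x ∈ Icc ε (1 - ε), eVariationOn (g x) univ < ⊤

/-- The transition probability `P_x`, i.e. the law of `T x + Y` with `Y ∼ g x`: it has the density
`y ↦ g x (y - T x)` if `s x > 0`, and it is the Dirac mass at `T x` if there is no noise. -/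
def transition (T s : ℝ → ℝ) (g : ℝ → ℝ → ℝ) (x : ℝ) : Measure ℝ :=
  open Classical in
  if 0 < s x then volume.withDensity (fun y => ENNReal.ofReal (g x (y - T x)))
  else Measure.dirac (T x)

/-- `μ` is stationary for the transition probabilities `P`: `∫ P_x(A) dμ(x) = μ(A)`. -/
def IsStationary (P : ℝ → Measure ℝ) (μ : Measure ℝ) : Prop :=
  ∀ A : Set ℝ, MeasurableSet A → ∫⁻ x, P x A ∂μ = μ A

/-- `μ` is concentrated on `I` and has there a density of bounded variation with respect to
Lebesgue measure. -/
def HasBVDensity (I : Set ℝ) (μ : Measure ℝ) : Prop :=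
  ∃ h : ℝ → ℝ, (∀ x ∈ I, 0 ≤ h x) ∧ BoundedVariationOn h I ∧
    μ = (volume.restrict I).withDensity (fun x => ENNReal.ofReal (h x))

/-- `μ` is a stationary probability measure with `BV` density of the noisy chain on `[-Γ, 1]`. -/
structure IsStationaryBV (T : ℝ → ℝ) (c : ℝ) (s : ℝ → ℝ) (g : ℝ → ℝ → ℝ) (μ : Measure ℝ) :
    Prop where
  isProbabilityMeasure : IsProbabilityMeasure μ
  isStationary : IsStationary (transition T s g) μ
  hasBVDensity : HasBVDensity (stateSpace T c) μ

end NoisyUnimodal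

end

/-! The noise is positive inside `(0, 1)`, so all the work takes place on an interval `[a, b]`, `b =
1 - Γ/2`, which no transition leaves and on which the noise densities have uniformly bounded
variation, hence are also uniformly bounded.

Existence: the transfer operator preserves mass and keeps densities bounded, so its Cesàro means
have a weak limit in `L²`, which is invariant (`exists_invariant_density`). Stationarity then writes
the measure as an average of noise densities, and this average inherits bounded variation
(`exists_density`).

Confinement: a stationary measure with a density does not see the points `0` and `1`, and mass close
to `0` drifts to the right without returning, so the measure lives on `[a, b]`
(`measure_compl_trapping`).

Support and uniqueness: the support of a stationary measure is closed and contains the whole noise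
interval around `T x` for each of its points `x` (`Icc_subset_support`). Such a set must contain a
neighbourhood of an attracting cycle (`cycle_subset_interior`) or the chaotic core (`core_subset`),
so any two nonzero stationary measures on `[a, b]` have supports overlapping in an open set. If `μ ≠
ν` were both stationary, their excesses over the minimum of `μ` and `ν` would be stationary, nonzero
and mutually singular; almost everywhere continuity of BV densities makes this incompatible with the
overlap (`eq_of_isStationary`). -/

noncomputable section

namespace NoisyUnimodal

/-! ### Trapping intervals, transition probabilities and invariance of supports -/

/-- The interval `[a, b]` is a trapping region in which the noise has positive size and densities
of uniformly bounded variation. -/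
structure IsTrapping (T s : ℝ → ℝ) (g : ℝ → ℝ → ℝ) (a b : ℝ) (K : NNReal) : Prop where
  lt : a < b
  continuousOn : ContinuousOn T (Icc a b)
  size_continuousOn : ContinuousOn s (Icc a b)
  size_pos : ∀ x ∈ Icc a b, 0 < s x
  le_sub : ∀ x ∈ Icc a b, a ≤ T x - s x
  add_le : ∀ x ∈ Icc a b, T x + s x ≤ b
  measurable : Measurable (Function.uncurry g)
  nonneg : ∀ x ∈ Icc a b, ∀ y, 0 ≤ g x y
  lintegral_eq_one : ∀ x ∈ Icc a b, ∫⁻ y, ENNReal.ofReal (g x y) = 1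
  support_eq : ∀ x ∈ Icc a b,
    (volume.withDensity (fun y => ENNReal.ofReal (g x y))).support = Icc (-s x) (s x)
  variation_le : ∀ x ∈ Icc a b, eVariationOn (g x) univ ≤ K

variable {T s : ℝ → ℝ} {g : ℝ → ℝ → ℝ} {c a b : ℝ} {K : NNReal}

/-- Mass and support are prescribed for the centred noise law; translation carries them over to
`P_x`. -/
lemma transition_eq_map {x : ℝ} (hx : 0 < s x) :
    transition T s g x =
      (volume.withDensity (fun y => ENNReal.ofReal (g x y))).map (fun y => y + T x) := by
  ext A hA
  rw [Measure.map_apply (by fun_prop) hA, transition, if_pos hx, withDensity_apply _ hA,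
    withDensity_apply _ (hA.preimage (by fun_prop)), ← lintegral_indicator hA,
    ← lintegral_indicator (hA.preimage (by fun_prop)),
    ← lintegral_sub_right_eq_self (indicator ((fun y => y + T x) ⁻¹' A) _) (T x)]
  congr 1
  ext y
  have hiff : y - T x ∈ (fun y => y + T x) ⁻¹' A ↔ y ∈ A := by simp
  by_cases hy : y ∈ A
  · rw [indicator_of_mem hy, indicator_of_mem (hiff.2 hy)]
  · rw [indicator_of_notMem hy, indicator_of_notMem (mt hiff.1 hy)]

lemma transition_of_not_pos {x : ℝ} (hx : ¬ 0 < s x) :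
    transition T s g x = Measure.dirac (T x) := by
  rw [transition, if_neg hx]

lemma transition_univ {x : ℝ} (hx : 0 < s x)
    (h1 : ∫⁻ y, ENNReal.ofReal (g x y) = 1) : transition T s g x univ = 1 := by
  rw [transition_eq_map hx, Measure.map_apply (by fun_prop) MeasurableSet.univ,
    withDensity_apply _ (by simp)]
  simpa using h1

lemma transition_compl_Icc {x : ℝ} (hx : 0 < s x)
    (h1 : (volume.withDensity (fun y => ENNReal.ofReal (g x y))).support = Icc (-s x) (s x)) :
    transition T s g x (Icc (T x - s x) (T x + s x))ᶜ = 0 := by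
  rw [transition_eq_map hx, Measure.map_apply (by fun_prop) measurableSet_Icc.compl]
  have : (fun y => y + T x) ⁻¹' (Icc (T x - s x) (T x + s x))ᶜ = (Icc (-s x) (s x))ᶜ := by
    ext y
    simp only [mem_preimage, mem_compl_iff, mem_Icc, not_iff_not]
    constructor <;> rintro ⟨h, h'⟩ <;> constructor <;> linarith
  rw [this, ← h1, Measure.measure_compl_support]

lemma transition_pos_of_mem {x : ℝ} (hx : 0 < s x)
    (h1 : (volume.withDensity (fun y => ENNReal.ofReal (g x y))).support = Icc (-s x) (s x))
    {U : Set ℝ} (hU : IsOpen U) {y : ℝ} (hyU : y ∈ U) (hy : y ∈ Icc (T x - s x) (T x + s x)) :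
    0 < transition T s g x U := by
  rw [transition_eq_map hx, Measure.map_apply (by fun_prop) hU.measurableSet]
  have hmem : y - T x ∈ Icc (-s x) (s x) := ⟨by linarith [hy.1], by linarith [hy.2]⟩
  rw [← h1, Measure.mem_support_iff_forall] at hmem
  exact hmem _ ((hU.preimage (by fun_prop)).mem_nhds (by simpa using hyU))

namespace IsTrapping

variable (h : IsTrapping T s g a b K)
include h

lemma transition_univ {x : ℝ} (hx : x ∈ Icc a b) : transition T s g x univ = 1 :=
  NoisyUnimodal.transition_univ (h.size_pos x hx) (h.lintegral_eq_one x hx)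

lemma Icc_subset {x : ℝ} (hx : x ∈ Icc a b) : Icc (T x - s x) (T x + s x) ⊆ Icc a b :=
  Icc_subset_Icc (h.le_sub x hx) (h.add_le x hx)

lemma transition_compl {x : ℝ} (hx : x ∈ Icc a b) : transition T s g x (Icc a b)ᶜ = 0 :=
  measure_mono_null (compl_subset_compl.2 (h.Icc_subset hx))
    (transition_compl_Icc (h.size_pos x hx) (h.support_eq x hx))

/-- The noise densities are bounded by the bound on their variations. -/
lemma density_le {x : ℝ} (hx : x ∈ Icc a b) (y : ℝ) : g x y ≤ K := by
  by_contra! hlt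
  -- A value above the variation bound would keep the density above a positive constant on all of
  -- `ℝ`, giving infinite mass.
  have hbd : ∀ z, g x y - K ≤ g x z := fun z => by
    have h1 : edist (g x y) (g x z) ≤ K :=
      (eVariationOn.edist_le _ (mem_univ y) (mem_univ z)).trans (h.variation_le x hx)
    have h2 : dist (g x y) (g x z) ≤ K := by
      rw [edist_dist] at h1
      exact (ENNReal.ofReal_le_coe).1 h1
    rw [Real.dist_eq] at h2
    linarith [le_abs_self (g x y - g x z)]
  have h3 : ∫⁻ _ : ℝ, ENNReal.ofReal (g x y - K) ≤ ∫⁻ z, ENNReal.ofReal (g x z) :=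
    lintegral_mono fun z => ENNReal.ofReal_le_ofReal (hbd z)
  rw [h.lintegral_eq_one x hx, lintegral_const, Real.volume_univ, ENNReal.mul_top] at h3
  · simp at h3
  · simpa using hlt

/-- The transition densities, extended measurably outside of the trapping region. -/
def kernel (T : ℝ → ℝ) (g : ℝ → ℝ → ℝ) (a b : ℝ) (x y : ℝ) : ℝ :=
  g x (y - (Icc a b).indicator T x)

omit h in
lemma kernel_of_mem {x : ℝ} (hx : x ∈ Icc a b) (y : ℝ) : kernel T g a b x y = g x (y - T x) := by
  rw [kernel, indicator_of_mem hx]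

lemma measurable_kernel : Measurable (Function.uncurry (kernel T g a b)) := by
  have hT : Measurable ((Icc a b).indicator T) := by
    classical
    rw [← piecewise_eq_indicator]
    exact h.continuousOn.measurable_piecewise continuousOn_const measurableSet_Icc
  exact h.measurable.comp (measurable_fst.prodMk (measurable_snd.sub (hT.comp measurable_fst)))

lemma transition_apply {x : ℝ} (hx : x ∈ Icc a b) {A : Set ℝ} (hA : MeasurableSet A) :
    transition T s g x A = ∫⁻ y in A, ENNReal.ofReal (kernel T g a b x y) := by
  rw [transition, if_pos (h.size_pos x hx), withDensity_apply _ hA]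
  simp only [kernel_of_mem hx]

lemma aemeasurable_transition {μ : Measure ℝ} (hμ : μ (Icc a b)ᶜ = 0) {A : Set ℝ}
    (hA : MeasurableSet A) : AEMeasurable (fun x => transition T s g x A) μ := by
  refine ⟨fun x => ∫⁻ y in A, ENNReal.ofReal (kernel T g a b x y), ?_, ?_⟩
  · have := h.measurable_kernel
    exact Measurable.lintegral_prod_right (f := fun x y => ENNReal.ofReal (kernel T g a b x y))
      this.ennreal_ofReal
  · filter_upwards [mem_ae_iff.2 hμ] with x hx using h.transition_apply hx hA

/-- The support of a stationary measure is invariant under the noisy dynamics. -/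
lemma Icc_subset_support {μ : Measure ℝ} (hμ : μ (Icc a b)ᶜ = 0)
    (hst : IsStationary (transition T s g) μ) {x : ℝ} (hx : x ∈ μ.support) :
    Icc (T x - s x) (T x + s x) ⊆ μ.support := by
  have hsub : μ.support ⊆ Icc a b :=
    Measure.support_subset_of_isClosed isClosed_Icc (mem_ae_iff.2 hμ)
  have hO : MeasurableSet μ.supportᶜ := Measure.isOpen_compl_support.measurableSet
  -- The complement of the support is null, so by stationarity almost no point jumps into it.
  have h0 : ∀ᵐ z ∂μ, transition T s g z μ.supportᶜ = 0 := by
    have := hst _ hO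
    rw [Measure.measure_compl_support, lintegral_eq_zero_iff' (h.aemeasurable_transition hμ hO)]
      at this
    exact this
  by_contra hcon
  obtain ⟨y, hy, hyS⟩ := not_subset.1 hcon
  have hxI := hsub hx
  have hsx := h.size_pos x hxI
  obtain ⟨r, hr, hrS⟩ := Metric.isOpen_iff.1 Measure.isOpen_compl_support y hyS
  have hT := h.continuousOn x hxI
  have hs := h.size_continuousOn x hxI
  -- By continuity the noise intervals of all `z` near `x` come within `r / 2` of `y`, so these `z`
  -- jump out of the support with positive probability.
  have key : ∀ᶠ z in 𝓝[Icc a b] x, T z - s z < y + r / 2 ∧ y - r / 2 < T z + s z := by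
    have e1 : ∀ᶠ z in 𝓝[Icc a b] x, T z - s z < y + r / 2 :=
      (hT.sub hs).eventually (eventually_lt_nhds (by simp only [Pi.sub_apply]; linarith [hy.1]))
    have e2 : ∀ᶠ z in 𝓝[Icc a b] x, y - r / 2 < T z + s z :=
      (hT.add hs).eventually (eventually_gt_nhds (by simp only [Pi.add_apply]; linarith [hy.2]))
    exact e1.and e2
  obtain ⟨U, hU, hUz⟩ := mem_nhdsWithin_iff_exists_mem_nhds_inter.1 key
  have hpos := (Measure.mem_support_iff_forall x).1 hx U hU
  have : μ U = 0 := by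
    have : ∀ᵐ z ∂μ, z ∉ U := by
      filter_upwards [h0, mem_ae_iff.2 hμ] with z hz hzI hzU
      obtain ⟨k1, k2⟩ := hUz ⟨hzU, hzI⟩
      have hsz := h.size_pos z hzI
      -- `w` is `y` clamped to the noise interval of `z`.
      set w := max (T z - s z) (min y (T z + s z)) with hw
      have hw1 : w ∈ Icc (T z - s z) (T z + s z) :=
        ⟨le_max_left _ _, max_le (by linarith) (min_le_right _ _)⟩
      have hw2 : w ∈ μ.supportᶜ := by
        apply hrS
        rw [Metric.mem_ball, Real.dist_eq, abs_lt]
        constructor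
        · have : y - r / 2 ≤ w := le_max_of_le_right (le_min (by linarith) k2.le)
          linarith
        · have : w ≤ y + r / 2 := max_le k1.le ((min_le_left _ _).trans (by linarith))
          linarith
      exact (transition_pos_of_mem hsz (h.support_eq z hzI)
        Measure.isOpen_compl_support hw2 hw1).ne' hz
    simpa [ae_iff] using this
  exact hpos.ne' this

end IsTrapping

/-! ### Weak limits of Cesàro means and invariant densities -/

section WeakLimit

variable {H : Type*} [NormedAddCommGroup H] [InnerProductSpace ℝ H] [CompleteSpace H]

/-- A bounded sequence in a Hilbert space has a weak limit along some ultrafilter. -/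
lemma exists_weak_ultrafilter_limit (u : ℕ → H) (R : ℝ) (hu : ∀ n, ‖u n‖ ≤ R) :
    ∃ (w : H) (F : Ultrafilter ℕ), (F : Filter ℕ) ≤ atTop ∧
      ∀ φ, Tendsto (fun n => inner ℝ (u n) φ) F (𝓝 (inner ℝ w φ)) := by
  let L : ℕ → WeakDual ℝ H := fun n =>
    WeakDual.toStrongDual.symm (InnerProductSpace.toDual ℝ H (u n))
  -- Banach–Alaoglu, through the Riesz identification with the dual. An ultrafilter replaces a
  -- subsequence, so separability is not needed.
  have hc := WeakDual.isCompact_closedBall (𝕜 := ℝ) (E := H) 0 R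
  obtain ⟨ℓ, -, hℓ⟩ := hc.ultrafilter_le_nhds ((hyperfilter ℕ).map L) (by
    rw [Ultrafilter.coe_map]
    refine le_principal_iff.2 (mem_map.2 (univ_mem' fun n => ?_))
    simpa [L] using hu n)
  refine ⟨(InnerProductSpace.toDual ℝ H).symm (WeakDual.toStrongDual ℓ), hyperfilter ℕ,
    Nat.hyperfilter_le_atTop, fun φ => ?_⟩
  have h1 : Tendsto L (hyperfilter ℕ) (𝓝 ℓ) := hℓ
  have h2 := ((WeakDual.eval_continuous (𝕜 := ℝ) φ).tendsto ℓ).comp h1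
  rw [InnerProductSpace.toDual_symm_apply]
  exact h2

/-- Weak limits of Cesàro means of a bounded sequence. -/
lemma exists_weak_cesaro_limit (e : ℕ → H) (R : ℝ) (he : ∀ n, ‖e n‖ ≤ R) :
    ∃ w : H, (∀ φ ψ, (∀ n, inner ℝ (e n) φ = inner ℝ (e (n + 1)) ψ) →
        inner ℝ w φ = inner ℝ w ψ) ∧
      (∀ φ, (∀ n, 0 ≤ inner ℝ (e n) φ) → 0 ≤ inner ℝ w φ) ∧
      ∀ φ C, (∀ n, inner ℝ (e n) φ = C) → inner ℝ w φ = C := by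
  let u : ℕ → H := fun n => ((n : ℝ) + 1)⁻¹ • ∑ i ∈ Finset.range (n + 1), e i
  have hu : ∀ n, ‖u n‖ ≤ R := fun n => by
    have hn : (0 : ℝ) < n + 1 := by positivity
    have h1 : ‖∑ i ∈ Finset.range (n + 1), e i‖ ≤ (n + 1) * R := by
      refine (norm_sum_le_of_le _ fun i _ => he i).trans ?_
      simp
    rw [norm_smul, Real.norm_of_nonneg (by positivity), inv_mul_le_iff₀ hn]
    exact h1
  obtain ⟨w, F, hF, hw⟩ := exists_weak_ultrafilter_limit u R hu
  have hin : ∀ n φ, inner ℝ (u n) φ =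
      ((n : ℝ) + 1)⁻¹ * ∑ i ∈ Finset.range (n + 1), inner ℝ (e i) φ := fun n φ => by
    simp only [u, real_inner_smul_left, sum_inner]
  refine ⟨w, fun φ ψ h => ?_, fun φ h => ?_, fun φ C h => ?_⟩
  · have h1 := (hw φ).sub (hw ψ)
    have h2 : Tendsto (fun n => inner ℝ (u n) φ - inner ℝ (u n) ψ) F (𝓝 0) := by
      have hz : Tendsto (fun n : ℕ => (2 * (R * ‖ψ‖)) * ((n : ℝ) + 1)⁻¹) F (𝓝 0) := by
        have := (tendsto_one_div_add_atTop_nhds_zero_nat (𝕜 := ℝ)).const_mul (2 * (R * ‖ψ‖))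
        simp only [one_div, mul_zero] at this
        exact this.mono_left hF
      refine squeeze_zero_norm (fun n => ?_) hz
      -- The relation between `φ` and `ψ` makes the difference of the means telescope.
      have heq : inner ℝ (u n) φ - inner ℝ (u n) ψ =
          ((n : ℝ) + 1)⁻¹ * (inner ℝ (e (n + 1)) ψ - inner ℝ (e 0) ψ) := by
        rw [hin, hin, ← mul_sub, ← Finset.sum_range_sub (fun i => inner ℝ (e i) ψ),
          ← Finset.sum_sub_distrib]
        simp only [h]
      have hb : ∀ i, ‖inner ℝ (e i) ψ‖ ≤ R * ‖ψ‖ := fun i =>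
        (norm_inner_le_norm _ _).trans (mul_le_mul_of_nonneg_right (he i) (norm_nonneg _))
      rw [heq, norm_mul, Real.norm_of_nonneg (by positivity), mul_comm]
      refine mul_le_mul_of_nonneg_right ((norm_sub_le _ _).trans ?_) (by positivity)
      linarith [hb (n + 1), hb 0]
    exact sub_eq_zero.1 (tendsto_nhds_unique h1 h2)
  · refine ge_of_tendsto' (hw φ) fun n => ?_
    rw [hin]
    exact mul_nonneg (by positivity) (Finset.sum_nonneg fun i _ => h i)
  · refine tendsto_nhds_unique (hw φ) (tendsto_const_nhds.congr fun n => ?_)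
    rw [hin]
    simp only [h, Finset.sum_const, Finset.card_range, nsmul_eq_mul]
    push_cast
    field_simp

end WeakLimit

/-- A bounded Markov kernel density over a finite measure admits an invariant density. -/
lemma exists_invariant_density {X : Type*} [MeasurableSpace X] (ν : Measure X)
    [IsFiniteMeasure ν] [NeZero ν] (k : X → X → ℝ) (hk : Measurable (Function.uncurry k))
    (K : ℝ) (h0 : ∀ x y, 0 ≤ k x y) (hK : ∀ x y, k x y ≤ K)
    (h1 : ∀ᵐ x ∂ν, ∫ y, k x y ∂ν = 1) :
    ∃ f : X → ℝ, Integrable f ν ∧ 0 ≤ᵐ[ν] f ∧ ∫ x, f x ∂ν = 1 ∧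
      ∀ A, MeasurableSet A → ∫ x, f x * ∫ y in A, k x y ∂ν ∂ν = ∫ y in A, f y ∂ν := by
  -- `Q` is the transfer operator on densities. `C` bounds the constant initial density and, as `Q f
  -- ≤ K` for densities `f`, all its iterates.
  let Q : (X → ℝ) → X → ℝ := fun f y => ∫ x, f x * k x y ∂ν
  let C : ℝ := max K (ν.real univ)⁻¹
  have hν : 0 < ν.real univ := by simp [Measure.real, ENNReal.toReal_pos_iff, NeZero.ne ν]
  have hC : 0 ≤ C := le_max_of_le_right (by positivity)
  have intg : ∀ {f : X → ℝ} {D : ℝ} (ρ : Measure X) [IsFiniteMeasure ρ], Measurable f →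
      (∀ x, 0 ≤ f x) → (∀ x, f x ≤ D) → Integrable f ρ := fun ρ _ hf hf0 hf1 =>
    Integrable.of_bound hf.aestronglyMeasurable _
      (Eventually.of_forall fun x => by rw [Real.norm_of_nonneg (hf0 x)]; exact hf1 x)
  have mulint : ∀ {f : X → ℝ}, Measurable f → (∀ x, 0 ≤ f x) → (∀ x, f x ≤ C) →
      ∀ y, Integrable (fun x => f x * k x y) ν := fun {f} hf hf0 hf1 y =>
    intg (D := C * K) ν (hf.mul hk.of_uncurry_right) (fun x => mul_nonneg (hf0 x) (h0 x y))
      fun x => mul_le_mul (hf1 x) (hK x y) (h0 x y) hC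
  have hkA : ∀ A, Measurable fun x => ∫ y in A, k x y ∂ν := fun A =>
    (hk.stronglyMeasurable.integral_prod_right' (ν := ν.restrict A)).measurable
  have hkA0 : ∀ A x, 0 ≤ ∫ y in A, k x y ∂ν := fun A x => integral_nonneg (h0 x)
  have hkA1 : ∀ A x, ∫ y in A, k x y ∂ν ≤ K * ν.real univ := fun A x => by
    have hb : ∫ y in A, k x y ∂ν ≤ ∫ y, k x y ∂ν :=
      setIntegral_le_integral (intg ν hk.of_uncurry_left (h0 x) (hK x))
        (Eventually.of_forall (h0 x))
    refine hb.trans ((integral_mono (intg ν hk.of_uncurry_left (h0 x) (hK x))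
      (integrable_const K) (hK x)).trans ?_)
    simp [mul_comm]
  have swap : ∀ {f : X → ℝ}, Measurable f → (∀ x, 0 ≤ f x) → (∀ x, f x ≤ C) → ∀ A,
      ∫ x, f x * ∫ y in A, k x y ∂ν ∂ν = ∫ y in A, Q f y ∂ν := fun {f} hf hf0 hf1 A => by
    simp only [Q, ← integral_const_mul]
    refine integral_integral_swap (f := fun x y => f x * k x y) ?_
    refine Integrable.of_bound (C := C * K)
      ((hf.comp measurable_fst).mul hk).aestronglyMeasurable (Eventually.of_forall fun p => ?_)
    rw [Function.uncurry_apply_pair, Real.norm_of_nonneg (mul_nonneg (hf0 _) (h0 _ _))]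
    exact mul_le_mul (hf1 _) (hK _ _) (h0 _ _) hC
  let f : ℕ → X → ℝ := fun n => Q^[n] fun _ => (ν.real univ)⁻¹
  have fsucc : ∀ n, f (n + 1) = Q (f n) := fun n => Function.iterate_succ_apply' _ _ _
  have hf : ∀ n, Measurable (f n) ∧ (∀ x, 0 ≤ f n x) ∧ (∀ x, f n x ≤ C) ∧
      ∫ x, f n x ∂ν = 1 := by
    intro n
    induction n with
    | zero =>
      refine ⟨measurable_const, fun x => by simp only [f, Function.iterate_zero, id]; positivity,
        fun x => le_max_right _ _, ?_⟩
      simp only [f, Function.iterate_zero, id, integral_const, smul_eq_mul]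
      exact mul_inv_cancel₀ hν.ne'
    | succ n ih =>
      obtain ⟨m, p, q, r⟩ := ih
      rw [fsucc]
      refine ⟨?_, fun y => integral_nonneg fun x => mul_nonneg (p x) (h0 x y), fun y => ?_, ?_⟩
      · exact (StronglyMeasurable.integral_prod_left' (μ := ν) (f := fun z : X × X =>
          f n z.1 * k z.1 z.2)
          ((m.comp measurable_fst).mul hk).stronglyMeasurable).measurable
      · have : Q (f n) y ≤ ∫ x, f n x * K ∂ν :=
          integral_mono (mulint m p q y) ((intg ν m p q).mul_const K)
            fun x => mul_le_mul_of_nonneg_left (hK x y) (p x)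
        rw [integral_mul_const, r, one_mul] at this
        exact this.trans (le_max_left _ _)
      · have := swap m p q univ
        rw [Measure.restrict_univ] at this
        rw [← this, ← r]
        refine integral_congr_ae ?_
        filter_upwards [h1] with x hx
        simp [hx]
  have mem : ∀ n, MemLp (f n) 2 ν := fun n =>
    MemLp.of_bound (hf n).1.aestronglyMeasurable C (Eventually.of_forall fun x => by
      rw [Real.norm_of_nonneg ((hf n).2.1 x)]; exact (hf n).2.2.1 x)
  let e : ℕ → Lp ℝ 2 ν := fun n => (mem n).toLp
  have inner_e : ∀ n {φ : X → ℝ} (hφ : MemLp φ 2 ν), inner ℝ (e n) hφ.toLp =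
      ∫ x, f n x * φ x ∂ν := fun n φ hφ => by
    rw [L2.inner_def]
    refine integral_congr_ae ?_
    filter_upwards [(mem n).coeFn_toLp, hφ.coeFn_toLp] with x hx hx'
    simp only [e, hx, hx', RCLike.inner_apply, conj_trivial]
    ring
  have norm_e : ∀ n, ‖e n‖ ≤ (ν.real univ) ^ (2 : ENNReal).toReal⁻¹ * C := fun n => by
    refine Lp.norm_le_of_ae_bound hC ?_
    filter_upwards [(mem n).coeFn_toLp] with x hx
    simp only [e, hx, Real.norm_of_nonneg ((hf n).2.1 x)]
    exact (hf n).2.2.1 x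
  obtain ⟨w, w1, w2, w3⟩ := exists_weak_cesaro_limit e _ norm_e
  have hwint : Integrable w ν := (Lp.memLp w).integrable (by norm_num)
  have inner_w : ∀ {φ : X → ℝ} (hφ : MemLp φ 2 ν), inner ℝ w hφ.toLp =
      ∫ x, w x * φ x ∂ν := fun {φ} hφ => by
    rw [L2.inner_def]
    refine integral_congr_ae ?_
    filter_upwards [hφ.coeFn_toLp] with x hx'
    simp only [hx', RCLike.inner_apply, conj_trivial]
    ring
  have memA : ∀ {A}, MeasurableSet A → MemLp (A.indicator fun _ => (1 : ℝ)) 2 ν := fun hA =>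
    memLp_indicator_const 2 hA 1 (Or.inr (measure_ne_top _ _))
  have intA : ∀ {A} (f : X → ℝ), MeasurableSet A →
      ∫ x, f x * A.indicator (fun _ => (1 : ℝ)) x ∂ν = ∫ x in A, f x ∂ν := fun {A} f hA => by
    rw [← integral_indicator hA]
    congr 1
    ext x
    by_cases hx : x ∈ A <;> simp [hx]
  have memk : ∀ {A}, MeasurableSet A → MemLp (fun x => ∫ y in A, k x y ∂ν) 2 ν := fun {A} _ =>
    MemLp.of_bound (hkA A).aestronglyMeasurable _ (Eventually.of_forall fun x => by
      rw [Real.norm_of_nonneg (hkA0 A x)]; exact hkA1 A x)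
  -- Positivity, mass and invariance are all tested against fixed `L²` functions, so they pass to
  -- the weak limit. For invariance the pair is `x ↦ ∫ y in A, k x y ∂ν` and the indicator of `A`,
  -- which are linked by Fubini (`swap`).
  refine ⟨w, hwint, ?_, ?_, fun A hA => ?_⟩
  · refine ae_nonneg_of_forall_setIntegral_nonneg hwint fun A hA _ => ?_
    rw [← intA _ hA, ← inner_w (memA hA)]
    refine w2 _ fun n => ?_
    rw [inner_e, intA _ hA]
    exact integral_nonneg (hf n).2.1
  · have := w3 (memA MeasurableSet.univ).toLp 1 fun n => by
      rw [inner_e, intA _ MeasurableSet.univ, Measure.restrict_univ, (hf n).2.2.2]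
    rwa [inner_w, intA _ MeasurableSet.univ, Measure.restrict_univ] at this
  · have := w1 (memk hA).toLp (memA hA).toLp fun n => by
      rw [inner_e, inner_e, intA _ hA, fsucc]
      exact swap (hf n).1 (hf n).2.1 (hf n).2.2.1 A
    rwa [inner_w, inner_w, intA _ hA] at this

/-! ### Stationary measures on the trapping interval: existence and BV densities -/

/-- The average of a family of functions of uniformly bounded variation has bounded variation. -/
lemma boundedVariationOn_integral {X : Type*} [MeasurableSpace X] (μ : Measure X)
    [IsFiniteMeasure μ] (k : X → ℝ → ℝ) (hk : ∀ y, Integrable (fun x => k x y) μ) (K : NNReal)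
    (hK : ∀ᵐ x ∂μ, eVariationOn (k x) univ ≤ K) :
    BoundedVariationOn (fun y => ∫ x, k x y ∂μ) univ := by
  have key : eVariationOn (fun y => ∫ x, k x y ∂μ) univ ≤ K * μ univ := by
    refine iSup_le ?_
    rintro ⟨n, u, hu, -⟩
    calc ∑ i ∈ Finset.range n, edist (∫ x, k x (u (i + 1)) ∂μ) (∫ x, k x (u i) ∂μ)
        ≤ ∑ i ∈ Finset.range n, ∫⁻ x, edist (k x (u (i + 1))) (k x (u i)) ∂μ := by
          refine Finset.sum_le_sum fun i _ => ?_
          rw [edist_eq_enorm_sub, ← integral_sub (hk _) (hk _)]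
          refine (enorm_integral_le_lintegral_enorm _).trans_eq ?_
          simp only [edist_eq_enorm_sub]
      _ = ∫⁻ x, ∑ i ∈ Finset.range n, edist (k x (u (i + 1))) (k x (u i)) ∂μ := by
          refine (lintegral_finsetSum' _ fun i _ => ?_).symm
          exact (hk _).aemeasurable.edist (hk _).aemeasurable
      _ ≤ ∫⁻ _, K ∂μ := by
          refine lintegral_mono_ae ?_
          filter_upwards [hK] with x hx
          exact (eVariationOn.sum_le hu fun i => mem_univ _).trans hx
      _ = K * μ univ := lintegral_const _
  exact ne_top_of_le_ne_top (ENNReal.mul_ne_top (by simp) (measure_ne_top _ _)) key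

namespace IsTrapping

variable (h : IsTrapping T s g a b K)
include h

lemma kernel_nonneg {x : ℝ} (hx : x ∈ Icc a b) (y : ℝ) : 0 ≤ kernel T g a b x y := by
  rw [kernel_of_mem hx]
  exact h.nonneg x hx _

lemma kernel_le {x : ℝ} (hx : x ∈ Icc a b) (y : ℝ) : kernel T g a b x y ≤ K := by
  rw [kernel_of_mem hx]
  exact h.density_le hx _

/-- A finite stationary measure on the trapping region has a density of bounded variation. -/
lemma exists_density {μ : Measure ℝ} [IsFiniteMeasure μ] (hμ : μ (Icc a b)ᶜ = 0)
    (hst : IsStationary (transition T s g) μ) :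
    ∃ f : ℝ → ℝ, (∀ x, 0 ≤ f x) ∧ BoundedVariationOn f univ ∧
      μ = volume.withDensity (fun x => ENNReal.ofReal (f x)) := by
  have hI : ∀ᵐ x ∂μ, x ∈ Icc a b := mem_ae_iff.2 hμ
  have hm := h.measurable_kernel
  have hint : ∀ y, Integrable (fun x => kernel T g a b x y) μ := fun y => by
    refine Integrable.of_bound hm.of_uncurry_right.aestronglyMeasurable K ?_
    filter_upwards [hI] with x hx
    rw [Real.norm_of_nonneg (h.kernel_nonneg hx y)]
    exact h.kernel_le hx y
  have hnn : ∀ y, 0 ≤ᵐ[μ] fun x => kernel T g a b x y := fun y => by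
    filter_upwards [hI] with x hx using h.kernel_nonneg hx y
  -- By stationarity `μ` is the `μ`-average of the `P_x`; Tonelli makes the averaged kernel its
  -- density.
  refine ⟨fun y => ∫ x, kernel T g a b x y ∂μ, fun y => integral_nonneg_of_ae (hnn y),
    boundedVariationOn_integral μ _ hint K ?_, ?_⟩
  · filter_upwards [hI] with x hx
    have : kernel T g a b x = g x ∘ fun y => y - T x := by
      ext y
      exact kernel_of_mem hx y
    rw [this]
    refine (eVariationOn.comp_le_of_monotoneOn (g x) (fun y => y - T x) ?_
      (mapsTo_univ _ _)).trans (h.variation_le x hx)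
    exact fun y _ z _ hyz => sub_le_sub_right hyz _
  · ext A hA
    rw [withDensity_apply _ hA, ← hst A hA]
    calc ∫⁻ x, transition T s g x A ∂μ
        = ∫⁻ x, (∫⁻ y in A, ENNReal.ofReal (kernel T g a b x y)) ∂μ := by
          refine lintegral_congr_ae ?_
          filter_upwards [hI] with x hx using h.transition_apply hx hA
      _ = ∫⁻ y in A, (∫⁻ x, ENNReal.ofReal (kernel T g a b x y) ∂μ) :=
          lintegral_lintegral_swap hm.ennreal_ofReal.aemeasurable
      _ = _ := by
          refine lintegral_congr fun y => ?_
          rw [ofReal_integral_eq_lintegral_ofReal (hint y) (hnn y)]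

/-- No mass leaves `[a, b]`, so the kernel is still Markov with respect to Lebesgue measure
restricted to `[a, b]`, and `exists_invariant_density` applies. -/
lemma exists_isStationary : ∃ μ : Measure ℝ, IsProbabilityMeasure μ ∧ μ (Icc a b)ᶜ = 0 ∧
    IsStationary (transition T s g) μ := by
  have hm := h.measurable_kernel
  let ν : Measure ℝ := volume.restrict (Icc a b)
  have hνI : ∀ᵐ x ∂ν, x ∈ Icc a b := ae_restrict_mem measurableSet_Icc
  have : NeZero ν := ⟨by
    intro h0
    have : ν univ = 0 := by rw [h0]; simp
    simp only [ν, Measure.restrict_apply_univ, Real.volume_Icc, ENNReal.ofReal_eq_zero] at this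
    linarith [h.lt]⟩
  -- Truncation changes nothing for `x ∈ [a, b]` and makes the bounds hold for every `x`.
  let k : ℝ → ℝ → ℝ := fun x y => max 0 (min K (kernel T g a b x y))
  have hk : Measurable (Function.uncurry k) :=
    measurable_const.max (measurable_const.min hm)
  have hkeq : ∀ x ∈ Icc a b, ∀ y, k x y = kernel T g a b x y := fun x hx y => by
    simp only [k]
    rw [min_eq_right (h.kernel_le hx y), max_eq_right (h.kernel_nonneg hx y)]
  have hk0 : ∀ x y, 0 ≤ k x y := fun x y => le_max_left _ _
  have hkK : ∀ x y, k x y ≤ K := fun x y => max_le K.2 (min_le_left _ _)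
  have hkint : ∀ x A, Integrable (k x) (ν.restrict A) := fun x A =>
    Integrable.of_bound hk.of_uncurry_left.aestronglyMeasurable K
      (Eventually.of_forall fun y => by rw [Real.norm_of_nonneg (hk0 x y)]; exact hkK x y)
  have htr : ∀ x ∈ Icc a b, ∀ A, MeasurableSet A →
      transition T s g x A = ENNReal.ofReal (∫ y in A, k x y ∂ν) := fun x hx A hA => by
    have hnull : transition T s g x A = transition T s g x (A ∩ Icc a b) := by
      refine le_antisymm ?_ (measure_mono inter_subset_left)
      calc transition T s g x A ≤ transition T s g x (A ∩ Icc a b) +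
            transition T s g x (Icc a b)ᶜ := by
            refine (measure_mono fun y hy => ?_).trans (measure_union_le _ _)
            by_cases hyI : y ∈ Icc a b
            · exact Or.inl ⟨hy, hyI⟩
            · exact Or.inr hyI
        _ = _ := by rw [h.transition_compl hx, add_zero]
    rw [hnull, h.transition_apply hx (hA.inter measurableSet_Icc),
      ofReal_integral_eq_lintegral_ofReal (hkint x A) (Eventually.of_forall (hk0 x)),
      Measure.restrict_restrict hA]
    simp only [hkeq x hx]
  obtain ⟨f, hf, hf0, hf1, hfA⟩ := exists_invariant_density ν k hk K hk0 hkK (by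
    filter_upwards [hνI] with x hx
    have h2 := htr x hx univ MeasurableSet.univ
    rw [h.transition_univ hx, Measure.restrict_univ] at h2
    exact ENNReal.ofReal_eq_one.1 h2.symm)
  have hofm : AEMeasurable (fun x => ENNReal.ofReal (f x)) ν := hf.aemeasurable.ennreal_ofReal
  let μ : Measure ℝ := ν.withDensity fun x => ENNReal.ofReal (f x)
  have hμA : ∀ A, MeasurableSet A → μ A = ENNReal.ofReal (∫ x in A, f x ∂ν) := fun A hA => by
    rw [withDensity_apply _ hA,
      ofReal_integral_eq_lintegral_ofReal hf.integrableOn (ae_restrict_of_ae hf0)]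
  refine ⟨μ, ⟨?_⟩, ?_, fun A hA => ?_⟩
  · rw [hμA _ MeasurableSet.univ, Measure.restrict_univ, hf1, ENNReal.ofReal_one]
  · exact withDensity_absolutelyContinuous _ _ (mem_ae_iff.1 hνI)
  · rw [hμA A hA, ← hfA A hA]
    have hν0 : ν (Icc a b)ᶜ = 0 := mem_ae_iff.1 hνI
    rw [lintegral_withDensity_eq_lintegral_mul₀ hofm (h.aemeasurable_transition hν0 hA),
      ofReal_integral_eq_lintegral_ofReal]
    · refine lintegral_congr_ae ?_
      filter_upwards [hνI, hf0] with x hx hx0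
      rw [Pi.mul_apply, htr x hx A hA, ENNReal.ofReal_mul hx0]
    · have hkA : StronglyMeasurable fun x => ∫ y in A, k x y ∂ν :=
        hk.stronglyMeasurable.integral_prod_right' (ν := ν.restrict A)
      refine hf.mul_bdd (c := K * ν.real A) hkA.aestronglyMeasurable
        (Eventually.of_forall fun x => ?_)
      refine (norm_integral_le_of_norm_le_const (C := K) (Eventually.of_forall fun y => ?_)).trans ?_
      · rw [Real.norm_of_nonneg (hk0 x y)]
        exact hkK x y
      · simp [Measure.real]
    · filter_upwards [hf0] with x hx
      exact mul_nonneg hx (integral_nonneg (hk0 x))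

end IsTrapping

/-! ### Uniqueness from overlapping supports -/

/-- BV functions are differentiable almost everywhere. Continuity points turn a strict inequality
between densities at a point into one on an open set. -/
lemma ae_continuousAt_of_boundedVariationOn {f : ℝ → ℝ} (hf : BoundedVariationOn f univ) :
    ∀ᵐ x, ContinuousAt f x := by
  filter_upwards [hf.locallyBoundedVariationOn.ae_differentiableWithinAt_of_mem] with x hx
  exact (hx (mem_univ x)).continuousWithinAt.continuousAt univ_mem

namespace IsTrapping

variable (h : IsTrapping T s g a b K)
include h

lemma lintegral_transition_univ {m : Measure ℝ} (hm : m (Icc a b)ᶜ = 0) :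
    ∫⁻ x, transition T s g x univ ∂m = m univ := by
  calc ∫⁻ x, transition T s g x univ ∂m = ∫⁻ _, 1 ∂m := by
        refine lintegral_congr_ae ?_
        filter_upwards [mem_ae_iff.2 hm] with x hx using h.transition_univ hx
    _ = m univ := by simp

/-- A finite measure which dominates its image under the noisy dynamics is stationary. -/
lemma isStationary_of_le {m : Measure ℝ} [IsFiniteMeasure m] (hm : m (Icc a b)ᶜ = 0)
    (hle : ∀ A, MeasurableSet A → ∫⁻ x, transition T s g x A ∂m ≤ m A) :
    IsStationary (transition T s g) m := by
  intro A hA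
  refine le_antisymm (hle A hA) ?_
  -- The image has the same total mass, so the inequalities for `A` and `Aᶜ` must both be
  -- equalities.
  have h1 : ∫⁻ x, transition T s g x A ∂m + ∫⁻ x, transition T s g x Aᶜ ∂m = m A + m Aᶜ := by
    rw [← lintegral_add_left' (h.aemeasurable_transition hm hA), measure_add_measure_compl hA,
      ← h.lintegral_transition_univ hm]
    exact lintegral_congr fun x => measure_add_measure_compl hA
  refine (ENNReal.add_le_add_iff_right (measure_ne_top m Aᶜ)).1 ?_
  rw [← h1]
  gcongr
  exact hle _ hA.compl

omit h in
lemma isStationary_sub {m μ : Measure ℝ} [IsFiniteMeasure m] (hle : m ≤ μ)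
    (hm : IsStationary (transition T s g) m) (hμ : IsStationary (transition T s g) μ)
    [IsFiniteMeasure μ] :
    IsStationary (transition T s g) (μ - m) := by
  intro A hA
  have h1 : ∫⁻ x, transition T s g x A ∂(μ - m + m) = (μ - m + m) A := by
    rw [Measure.sub_add_cancel_of_le hle, hμ A hA]
  rw [lintegral_add_measure, hm A hA, Measure.add_apply] at h1
  exact (ENNReal.add_left_inj (measure_ne_top m A)).1 h1

/-- Two stationary probability measures on the trapping region coincide if the supports of any two
nonzero stationary measures have interior points in common. -/
lemma eq_of_isStationary {μ ν : Measure ℝ} [IsProbabilityMeasure μ] [IsProbabilityMeasure ν]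
    (hμ : μ (Icc a b)ᶜ = 0) (hν : ν (Icc a b)ᶜ = 0)
    (hsμ : IsStationary (transition T s g) μ) (hsν : IsStationary (transition T s g) ν)
    (hW : ∀ ρ₁ ρ₂ : Measure ℝ, IsFiniteMeasure ρ₁ → IsFiniteMeasure ρ₂ → ρ₁ ≠ 0 → ρ₂ ≠ 0 →
      ρ₁ (Icc a b)ᶜ = 0 → ρ₂ (Icc a b)ᶜ = 0 → IsStationary (transition T s g) ρ₁ →
      IsStationary (transition T s g) ρ₂ →
      ∃ W : Set ℝ, IsOpen W ∧ W.Nonempty ∧ W ⊆ ρ₁.support ∧ W ⊆ ρ₂.support) : μ = ν := by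
  obtain ⟨D, hD, hDμ, hDν⟩ := hahn_decomposition μ ν
  -- The minimum of `μ` and `ν`, since `ν ≤ μ` on `D` and `μ ≤ ν` on `Dᶜ`.
  let m : Measure ℝ := ν.restrict D + μ.restrict Dᶜ
  have hmA : ∀ A, MeasurableSet A → m A = ν (A ∩ D) + μ (A ∩ Dᶜ) := fun A hA => by
    simp only [m, Measure.add_apply, Measure.restrict_apply hA]
  have hsplit : ∀ (κ : Measure ℝ) A, MeasurableSet A → κ A = κ (A ∩ D) + κ (A ∩ Dᶜ) :=
    fun κ A hA => by rw [← sdiff_eq, measure_inter_add_sdiff A hD]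
  have hmμ : m ≤ μ := Measure.le_iff.2 fun A hA => by
    rw [hmA A hA, hsplit μ A hA]
    exact add_le_add_left (hDμ _ (hA.inter hD) inter_subset_right) _
  have hmν : m ≤ ν := Measure.le_iff.2 fun A hA => by
    rw [hmA A hA, hsplit ν A hA]
    exact add_le_add_right (hDν _ (hA.inter hD.compl) inter_subset_right) _
  have : IsFiniteMeasure m := isFiniteMeasure_of_le μ hmμ
  have hm0 : m (Icc a b)ᶜ = 0 := le_antisymm ((hmμ _).trans hμ.le) zero_le
  have hsm : IsStationary (transition T s g) m := by
    refine h.isStationary_of_le hm0 fun A hA => ?_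
    calc ∫⁻ x, transition T s g x A ∂m
        = ∫⁻ x, transition T s g x (A ∩ D) ∂m + ∫⁻ x, transition T s g x (A ∩ Dᶜ) ∂m := by
          rw [← lintegral_add_left' (h.aemeasurable_transition hm0 (hA.inter hD))]
          exact lintegral_congr fun x => hsplit _ A hA
      _ ≤ ∫⁻ x, transition T s g x (A ∩ D) ∂ν + ∫⁻ x, transition T s g x (A ∩ Dᶜ) ∂μ :=
          add_le_add (lintegral_mono' hmν le_rfl) (lintegral_mono' hmμ le_rfl)
      _ = m A := by rw [hsν _ (hA.inter hD), hsμ _ (hA.inter hD.compl), hmA A hA]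
  have hle_of : ∀ κ : Measure ℝ, m ≤ κ → κ - m = 0 → κ ≤ m := fun κ hle h0 => by
    rw [← Measure.sub_add_cancel_of_le hle, h0, zero_add]
  by_contra hne
  -- If one excess vanished, one probability measure would be dominated by the other and hence equal
  -- to it.
  obtain ⟨W, hWo, hWne, hW1, hW2⟩ := hW (μ - m) (ν - m)
    inferInstance inferInstance
    (fun h0 => hne (Measure.eq_of_le_of_isProbabilityMeasure ((hle_of μ hmμ h0).trans hmν)))
    (fun h0 => hne (Measure.eq_of_le_of_isProbabilityMeasure ((hle_of ν hmν h0).trans hmμ)).symm)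
    (le_antisymm ((Measure.sub_le _).trans hμ.le) zero_le)
    (le_antisymm ((Measure.sub_le _).trans hν.le) zero_le)
    (isStationary_sub hmμ hsm hsμ) (isStationary_sub hmν hsm hsν)
  obtain ⟨f₁, hf₁, hb₁, hμf⟩ := h.exists_density hμ hsμ
  obtain ⟨f₂, hf₂, hb₂, hνf⟩ := h.exists_density hν hsν
  have hpos : ∀ κ : Measure ℝ, W ⊆ κ.support → ∀ U ⊆ W, IsOpen U → U.Nonempty → 0 < κ U :=
    fun κ hκ U hU hUo ⟨x, hx⟩ =>
      (Measure.mem_support_iff_forall x).1 (hκ (hU hx)) U (hUo.mem_nhds hx)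
  -- Otherwise `μ ≤ ν` on `W`, and `μ - m` would vanish on `W`, a nonempty open subset of its
  -- support.
  obtain ⟨x, hxW, hxlt, hc1, hc2⟩ : ∃ x ∈ W, f₂ x < f₁ x ∧ ContinuousAt f₁ x ∧
      ContinuousAt f₂ x := by
    by_contra! hcon
    have hle : ∀ A ⊆ W, MeasurableSet A → μ A ≤ ν A := fun A hA hAm => by
      rw [hμf, hνf, withDensity_apply _ hAm, withDensity_apply _ hAm]
      refine lintegral_mono_ae ?_
      filter_upwards [ae_restrict_of_ae (ae_continuousAt_of_boundedVariationOn hb₁),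
        ae_restrict_of_ae (ae_continuousAt_of_boundedVariationOn hb₂), ae_restrict_mem hAm]
        with x h1 h2 hxA
      refine ENNReal.ofReal_le_ofReal ?_
      by_contra! hlt
      exact hcon x (hA hxA) hlt h1 h2
    have h0 := hpos _ hW1 W Subset.rfl hWo hWne
    rw [Measure.sub_apply hWo.measurableSet hmμ, hmA W hWo.measurableSet,
      hsplit μ W hWo.measurableSet, tsub_eq_zero_of_le] at h0
    · exact lt_irrefl _ h0
    · exact add_le_add_left (hle _ inter_subset_left (hWo.measurableSet.inter hD)) _
  -- Near `x` the measure `m` agrees with `ν`, so `ν - m` vanishes on an open subset of its support.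
  have hev : ∀ᶠ z in 𝓝 x, z ∈ W ∧ f₂ z < f₁ z :=
    (hWo.eventually_mem hxW).and (hc2.eventually_lt hc1 hxlt)
  obtain ⟨U, hUs, hUo, hxU⟩ := eventually_nhds_iff.1 hev |>.imp fun U hU => hU
  have h0 := hpos _ hW2 U (fun z hz => (hUs z hz).1) hUo ⟨x, hxU⟩
  rw [Measure.sub_apply hUo.measurableSet hmν, hmA U hUo.measurableSet,
    hsplit ν U hUo.measurableSet, tsub_eq_zero_of_le] at h0
  · exact lt_irrefl _ h0
  · refine add_le_add_right ?_ _
    have hAm := hUo.measurableSet.inter hD.compl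
    rw [hμf, hνf, withDensity_apply _ hAm, withDensity_apply _ hAm]
    refine lintegral_mono_ae ?_
    filter_upwards [ae_restrict_mem hAm] with z hz
    exact ENNReal.ofReal_le_ofReal (hUs z hz.1).2.le

end IsTrapping

/-! ### Construction of the trapping interval and confinement of stationary measures -/

namespace IsUnimodal

variable (hT : IsUnimodal T c)
include hT

lemma continuousOn : ContinuousOn T (Icc 0 1) := hT.contDiffOn.continuousOn

lemma strictMonoOn_Icc : StrictMonoOn T (Icc 0 c) := by
  obtain ⟨h0, h1⟩ := hT.crit_mem
  intro x hx y hy hxy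
  rcases hy.2.lt_or_eq with hyc | rfl
  · exact hT.strictMonoOn ⟨hx.1, hxy.trans hyc⟩ ⟨hy.1, hyc⟩ hxy
  obtain ⟨m, hxm, hmy⟩ := exists_between hxy
  refine (hT.strictMonoOn ⟨hx.1, hxy⟩ ⟨hx.1.trans hxm.le, hmy⟩ hxm).trans_le ?_
  have hc : ContinuousWithinAt T (Ioo m y) y :=
    (hT.continuousOn y ⟨h0.le, h1.le⟩).mono fun z hz =>
      ⟨hx.1.trans (hxm.trans hz.1).le, hz.2.le.trans h1.le⟩
  have : (𝓝[Ioo m y] y).NeBot := right_nhdsWithin_Ioo_neBot hmy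
  refine ge_of_tendsto hc.tendsto (eventually_nhdsWithin_of_forall fun z hz => ?_)
  exact (hT.strictMonoOn ⟨hx.1.trans hxm.le, hmy⟩ ⟨hx.1.trans (hxm.trans hz.1).le, hz.2⟩ hz.1).le

lemma strictAntiOn_Icc : StrictAntiOn T (Icc c 1) := by
  obtain ⟨h0, h1⟩ := hT.crit_mem
  intro x hx y hy hxy
  rcases hx.1.lt_or_eq with hxc | rfl
  · exact hT.strictAntiOn ⟨hxc, hx.2⟩ ⟨hxc.trans hxy, hy.2⟩ hxy
  obtain ⟨m, hxm, hmy⟩ := exists_between hxy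
  refine (hT.strictAntiOn ⟨hxm, hmy.le.trans hy.2⟩ ⟨hxy, hy.2⟩ hmy).trans_le ?_
  have hc : ContinuousWithinAt T (Ioo c m) c :=
    (hT.continuousOn c ⟨h0.le, h1.le⟩).mono fun z hz =>
      ⟨h0.le.trans hz.1.le, (hz.2.trans hmy).le.trans hy.2⟩
  have : (𝓝[Ioo c m] c).NeBot := left_nhdsWithin_Ioo_neBot hxm
  refine ge_of_tendsto hc.tendsto (eventually_nhdsWithin_of_forall fun z hz => ?_)
  exact (hT.strictAntiOn ⟨hz.1, (hz.2.trans hmy).le.trans hy.2⟩ ⟨hxm, hmy.le.trans hy.2⟩ hz.2).le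

lemma le_peak {x : ℝ} (hx : x ∈ Icc (0 : ℝ) 1) : T x ≤ T c := by
  obtain ⟨h0, h1⟩ := hT.crit_mem
  rcases le_total x c with h | h
  · exact hT.strictMonoOn_Icc.monotoneOn ⟨hx.1, h⟩ ⟨h0.le, le_rfl⟩ h
  · exact hT.strictAntiOn_Icc.antitoneOn ⟨le_rfl, h1.le⟩ ⟨h, hx.2⟩ h

lemma peak_pos : 0 < T c := by
  obtain ⟨h0, h1⟩ := hT.crit_mem
  have := hT.strictMonoOn_Icc ⟨le_rfl, h0.le⟩ ⟨h0.le, le_rfl⟩ h0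
  rwa [hT.map_zero] at this

lemma gap_pos : 0 < gap T c := sub_pos.2 hT.peak_lt_one

lemma gap_lt_one : gap T c < 1 := by
  have := hT.peak_pos
  rw [gap]
  linarith

/-- The right end works because `T + s < Δ + Γ/2 = 1 - Γ/2`. For the left end, `T - s` is above the
diagonal near `0` and has a positive minimum `η` away from `0`; `a` is chosen below `η`. -/
lemma exists_isTrapping (hn : IsNoise T c s g) :
    ∃ a K, 0 < a ∧ a < 1 ∧ (∀ x ∈ Ioo 0 a, x < T x - s x) ∧
      IsTrapping T s g a (1 - gap T c / 2) K := by
  have hg0 := hT.gap_pos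
  have hg1 := hT.gap_lt_one
  set b := 1 - gap T c / 2 with hb
  obtain ⟨δ, hδ, hexp⟩ : ∃ δ > 0, ∀ x ∈ Ioo 0 δ, x < T x - s x := by
    obtain ⟨δ, hδ, h⟩ := mem_nhdsGT_iff_exists_Ioo_subset.1 hn.expanding
    exact ⟨δ, hδ, fun x hx => h hx⟩
  let d := min (δ / 2) (b / 2)
  have hd0 : 0 < d := lt_min (by linarith) (by linarith)
  have hdb : d ≤ b / 2 := min_le_right _ _
  have hdδ : d ≤ δ / 2 := min_le_left _ _
  have hcT : ContinuousOn T (Icc d b) :=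
    hT.continuousOn.mono (Icc_subset_Icc hd0.le (by linarith))
  have hcs : ContinuousOn s (Icc d b) :=
    hn.size_continuousOn.mono (Icc_subset_Ioo hd0 (by linarith))
  obtain ⟨z, hz, hzmin⟩ := isCompact_Icc.exists_isMinOn (nonempty_Icc.2 (by linarith))
    (hcT.sub hcs)
  let η := T z - s z
  have hη : 0 < η := hn.pos_of_le z ⟨by linarith [hz.1], hz.2⟩
  let a := min d η
  have ha0 : 0 < a := lt_min hd0 hη
  have had : a ≤ d := min_le_left _ _
  have hsub : Icc a b ⊆ Ioo 0 1 := Icc_subset_Ioo ha0 (by linarith)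
  have hstate : Icc a b ⊆ stateSpace T c := Icc_subset_Icc (by linarith) (by linarith)
  let ε := min a (gap T c / 2)
  have hε : 0 < ε := lt_min ha0 (by linarith)
  have hvar := hn.variation_lt_top ε hε
  have hεsub : Icc a b ⊆ Icc ε (1 - ε) :=
    Icc_subset_Icc (min_le_left _ _) (by linarith [min_le_right a (gap T c / 2)])
  refine ⟨a, (⨆ x ∈ Icc ε (1 - ε), eVariationOn (g x) univ).toNNReal, ha0, by linarith,
    fun x hx => hexp x ⟨hx.1, by linarith [hx.2]⟩, ?_⟩
  refine ⟨by linarith, hT.continuousOn.mono (hsub.trans Ioo_subset_Icc_self),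
    hn.size_continuousOn.mono hsub, fun x hx => hn.size_pos x (hsub hx), fun x hx => ?_,
    fun x hx => ?_, hn.measurable, fun x hx => hn.nonneg x (hstate hx) (hn.size_pos x (hsub hx)),
    fun x hx => hn.lintegral_eq_one x (hstate hx) (hn.size_pos x (hsub hx)),
    fun x hx => hn.support_eq x (hstate hx) (hn.size_pos x (hsub hx)), fun x hx => ?_⟩
  · by_cases hxd : x < d
    · exact (hx.1.trans (hexp x ⟨(hsub hx).1, by linarith⟩).le)
    · exact (min_le_right _ _).trans (hzmin ⟨not_lt.1 hxd, hx.2⟩)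
  · have h1 := hT.le_peak ⟨(hsub hx).1.le, (hsub hx).2.le⟩
    have h2 := hn.size_lt x (hsub hx)
    rw [gap] at *
    linarith
  · rw [ENNReal.coe_toNNReal hvar.ne]
    exact le_iSup₂ (f := fun x _ => eVariationOn (g x) univ) x (hεsub hx)

/-- A stationary measure with a density is concentrated on the trapping region. -/
lemma measure_compl_trapping (hext : IsExtended T c) (hn : IsNoise T c s g)
    (ha1 : a < 1)
    (hexp : ∀ x ∈ Ioo 0 a, x < T x - s x) (htr : IsTrapping T s g a (1 - gap T c / 2) K)
    {μ : Measure ℝ} [IsFiniteMeasure μ] (hac : μ ≪ volume) (hI : μ (stateSpace T c)ᶜ = 0)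
    (hst : IsStationary (transition T s g) μ) : μ (Icc a (1 - gap T c / 2))ᶜ = 0 := by
  have hg0 := hT.gap_pos
  have hg1 := hT.gap_lt_one
  have hgap : gap T c = 1 - T c := rfl
  set b := 1 - gap T c / 2 with hb
  -- This is where the density matters: `0` is a noiseless fixed point, so the Dirac mass there is
  -- stationary too.
  have hae : ∀ᵐ x ∂μ, x ∈ Ico (-gap T c) 0 ∪ Ioo 0 1 := by
    have h1 : ∀ᵐ x ∂μ, x ≠ 1 := hac.ae_le (Measure.ae_ne volume 1)
    have h0 : ∀ᵐ x ∂μ, x ≠ 0 := hac.ae_le (Measure.ae_ne volume 0)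
    filter_upwards [h1, h0, mem_ae_iff.2 hI] with x hx1 hx0 hx
    rcases lt_or_gt_of_ne hx0 with h | h
    · exact Or.inl ⟨hx.1, h⟩
    · exact Or.inr ⟨h, lt_of_le_of_ne hx.2 hx1⟩
  have hstate : Ioo 0 1 ⊆ stateSpace T c := Ioo_subset_Icc_self.trans
    (Icc_subset_Icc (by linarith) le_rfl)
  have hJ : ∀ x ∈ Ioo (0 : ℝ) 1, ∀ A, Disjoint A (Icc (T x - s x) (T x + s x)) →
      transition T s g x A = 0 := fun x hx A hA =>
    measure_mono_null hA.subset_compl_right (transition_compl_Icc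
      (hn.size_pos x hx) (hn.support_eq x (hstate hx) (hn.size_pos x hx)))
  have hneg : ∀ x ∈ Ico (-gap T c) 0, ∀ A, T x ∉ A → transition T s g x A = 0 :=
    fun x hx A hA => by
      rw [transition_of_not_pos (by rw [hn.size_nonpos x ⟨hx.1, hx.2.le⟩]; simp)]
      rw [Measure.dirac_apply, indicator_of_notMem hA]
  have hright : μ (Ioi b) = 0 := by
    rw [← hst _ measurableSet_Ioi]
    refine lintegral_eq_zero_of_ae_eq_zero ?_
    filter_upwards [hae] with x hx
    rcases hx with hx | hx
    · refine hneg x hx _ (notMem_Ioi.2 ?_)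
      have h1 := hext.antitoneOn ⟨le_rfl, by linarith⟩ hx hx.1
      linarith [hext.map_left_lt]
    · refine hJ x hx _ (disjoint_left.2 fun y hy hy' => ?_)
      have h1 := hT.le_peak ⟨hx.1.le, hx.2.le⟩
      have h2 := hn.size_lt x hx
      have h3 : b < y := hy
      linarith [hy'.2]
  have hleft : μ (Iic 0) = 0 := by
    rw [← hst _ measurableSet_Iic]
    refine lintegral_eq_zero_of_ae_eq_zero ?_
    have hb' : ∀ᵐ x ∂μ, x ≤ b := by
      filter_upwards [measure_eq_zero_iff_ae_notMem.1 hright] with x hx using not_lt.1 hx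
    filter_upwards [hae, hb'] with x hx hxb
    rcases hx with hx | hx
    · exact hneg x hx _ (notMem_Iic.2 (hext.pos x hx))
    · refine hJ x hx _ (disjoint_left.2 fun y hy hy' => ?_)
      have h1 := hn.pos_of_le x ⟨hx.1, hxb⟩
      have h3 : y ≤ 0 := hy
      linarith [hy'.1]
  -- Points of `(0, t]` that surely jump beyond `t`. Points of `(t, b]` surely stay beyond `t`, so
  -- stationarity of the mass of `(t, ∞)` leaves no room for `E t`.
  let E : ℝ → Set ℝ := fun t => Ioc 0 t ∩ {x | t < T x - s x}
  have hE : ∀ t ∈ Ioo 0 a, μ (E t) = 0 := fun t ht => by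
    have hco : ContinuousOn (fun x => T x - s x) (Ioc 0 t) :=
      (hT.continuousOn.mono fun x hx => ⟨hx.1.le, by linarith [hx.2, ht.2]⟩).sub
        (hn.size_continuousOn.mono fun x hx => ⟨hx.1, by linarith [hx.2, ht.2]⟩)
    have hEm : MeasurableSet (E t) := by
      obtain ⟨U, hU, hUeq⟩ := (continuousOn_iff'.1 hco) (Ioi t) isOpen_Ioi
      have : E t = U ∩ Ioc 0 t := by
        rw [← hUeq, inter_comm]
        rfl
      rw [this]
      exact hU.measurableSet.inter measurableSet_Ioc
    have hone : ∀ x ∈ Ioo (0 : ℝ) 1, t < T x - s x → transition T s g x (Ioi t) = 1 :=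
      fun x hx hlt => by
        have hsx := hn.size_pos x hx
        have h1 := NoisyUnimodal.transition_univ (T := T) hsx
          (hn.lintegral_eq_one x (hstate hx) hsx)
        have h2 : transition T s g x (Ioi t)ᶜ = 0 := hJ x hx _ (disjoint_left.2
          fun y hy hy' => hy (hlt.trans_le hy'.1))
        rw [← h1, ← measure_add_measure_compl measurableSet_Ioi, h2, add_zero]
    have hdisj : Disjoint (Ioc t b) (E t) :=
      disjoint_left.2 fun x hx hx' => not_lt.2 hx'.1.2 hx.1
    have hle : μ (Ioc t b) + μ (E t) ≤ μ (Ioi t) := by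
      rw [← hst _ measurableSet_Ioi, ← measure_union hdisj hEm]
      calc μ (Ioc t b ∪ E t) = ∫⁻ _ in Ioc t b ∪ E t, 1 ∂μ := by simp
        _ = ∫⁻ x in Ioc t b ∪ E t, transition T s g x (Ioi t) ∂μ := by
            refine setLIntegral_congr_fun (measurableSet_Ioc.union hEm) fun x hx => ?_
            rcases hx with hx | hx
            · refine (hone x ⟨ht.1.trans hx.1, by linarith [hx.2]⟩ ?_).symm
              by_cases hxa : x < a
              · exact hx.1.trans (hexp x ⟨ht.1.trans hx.1, hxa⟩)
              · exact ht.2.trans_le (htr.le_sub x ⟨not_lt.1 hxa, hx.2⟩)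
            · exact (hone x ⟨hx.1.1, by linarith [hx.1.2, ht.2]⟩ hx.2).symm
        _ ≤ _ := setLIntegral_le_lintegral _ _
    have heq : μ (Ioi t) ≤ μ (Ioc t b) := by
      refine (measure_mono (t := Ioc t b ∪ Ioi b) fun x hx => ?_).trans
        ((measure_union_le _ _).trans_eq (by rw [hright, add_zero]))
      by_cases hxb : x ≤ b
      · exact Or.inl ⟨hx, hxb⟩
      · exact Or.inr (not_le.1 hxb)
    have h3 := hle.trans heq
    by_contra hne
    exact (ENNReal.lt_add_right (measure_ne_top μ _) hne).not_ge h3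
  have hmid : μ (Ioo 0 a) = 0 := by
    refine measure_mono_null (t := ⋃ q : {q : ℚ // (q : ℝ) ∈ Ioo 0 a}, E (q : ℚ)) ?_
      (measure_iUnion_null fun q => hE _ q.2)
    intro x hx
    -- Any rational `q` between `x` and `min (T x - s x) a` puts `x` in `E q`, so countably many
    -- null sets cover `(0, a)`.
    obtain ⟨q, hq1, hq2⟩ := exists_rat_btwn (lt_min (hexp x hx) hx.2)
    exact mem_iUnion.2 ⟨⟨q, hx.1.trans hq1, hq2.trans_le (min_le_right _ _)⟩,
      ⟨hx.1, hq1.le⟩, hq2.trans_le (min_le_left _ _)⟩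
  refine measure_mono_null (t := Iic 0 ∪ Ioo 0 a ∪ Ioi b) (fun x hx => ?_)
    (measure_union_null (measure_union_null hleft hmid) hright)
  by_contra hcon
  simp only [mem_union, mem_Iic, mem_Ioo, mem_Ioi, not_or, not_and, not_le, not_lt] at hcon
  exact hx ⟨hcon.1.2 hcon.1.1, hcon.2⟩

end IsUnimodal

/-! ### Consequences of negative Schwarzian derivative and transitivity -/

/-- A negative second derivative would make `x` a local maximum as well, hence `f` locally constant.
Applied to `f = T'` to control `T'''`. -/
lemma deriv_deriv_nonneg_of_isLocalMin {f : ℝ → ℝ} {x : ℝ} (h : IsLocalMin f x)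
    (hf : ContinuousAt f x) : 0 ≤ deriv (deriv f) x := by
  by_contra! hneg
  have hmax := isLocalMax_of_deriv_deriv_neg hneg h.deriv_eq_zero hf
  have hconst : f =ᶠ[𝓝 x] fun _ => f x := by
    filter_upwards [h, hmax] with z h1 h2 using le_antisymm h2 h1
  have h2 : deriv f =ᶠ[𝓝 x] fun _ => 0 := by simpa using hconst.deriv
  rw [h2.deriv_eq, deriv_const] at hneg
  exact lt_irrefl _ hneg

namespace IsUnimodal

variable (hT : IsUnimodal T c)
include hT

lemma contDiffAt {x : ℝ} (hx : x ∈ Ioo (0 : ℝ) 1) : ContDiffAt ℝ 4 T x :=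
  hT.contDiffOn.contDiffAt (Icc_mem_nhds hx.1 hx.2)

lemma continuousAt_deriv {x : ℝ} (hx : x ∈ Ioo (0 : ℝ) 1) : ContinuousAt (deriv T) x := by
  have h1 : ContDiffOn ℝ 4 T (Ioo 0 1) := hT.contDiffOn.mono Ioo_subset_Icc_self
  exact (h1.continuousOn_deriv_of_isOpen isOpen_Ioo (by norm_num)).continuousAt
    (isOpen_Ioo.mem_nhds hx)

lemma exists_deriv_eq_slope {x y : ℝ} (hx : 0 ≤ x) (hxy : x < y) (hy : y ≤ 1) :
    ∃ z ∈ Ioo x y, deriv T z = (T y - T x) / (y - x) :=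
  _root_.exists_deriv_eq_slope T hxy (hT.continuousOn.mono (Icc_subset_Icc hx hy))
    fun _ hz => ((hT.contDiffAt ⟨hx.trans_lt hz.1, hz.2.trans_le hy⟩).differentiableAt
      (by norm_num)).differentiableWithinAt

lemma deriv_nonneg {x : ℝ} (hx : x ∈ Ioo (0 : ℝ) c) : 0 ≤ deriv T x := by
  rw [← derivWithin_of_isOpen isOpen_Ioo hx]
  exact (hT.strictMonoOn_Icc.monotoneOn.mono Ioo_subset_Icc_self).derivWithin_nonneg

/-- For negative Schwarzian derivative, the graph of the increasing branch cannot drop below the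
diagonal after having been above it, if its endpoint is above the diagonal. -/
lemma le_of_schwarzian_neg (hS : ∀ x ∈ Ioo (0 : ℝ) 1, x ≠ c → schwarzian T x < 0)
    (hc : c < T c) {p q : ℝ} (hp : 0 < p) (hpT : p < T p) (hpq : p < q) (hqc : q < c) :
    q ≤ T q := by
  by_contra! hlt
  have hc1 := hT.crit_mem.2
  -- The chords over `[0, p]`, `[p, q]`, `[q, c]` have slopes above, below and above `1`, so `T'`
  -- has an interior local minimum. There `T'' = 0`, `T''' ≥ 0` and `T' ≥ 0`, so the Schwarzian is
  -- nonnegative.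
  obtain ⟨u, hu, hu'⟩ := hT.exists_deriv_eq_slope le_rfl hp (by linarith)
  obtain ⟨v, hv, hv'⟩ := hT.exists_deriv_eq_slope hp.le hpq (by linarith)
  obtain ⟨w, hw, hw'⟩ := hT.exists_deriv_eq_slope (hp.trans hpq).le hqc hc1.le
  have hu1 : 1 < deriv T u := by
    rw [hu', hT.map_zero, sub_zero, sub_zero, one_lt_div hp]
    exact hpT
  have hv1 : deriv T v < 1 := by
    rw [hv', div_lt_one (by linarith)]
    linarith
  have hw1 : 1 < deriv T w := by
    rw [hw', one_lt_div (by linarith)]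
    linarith
  have huw : u < w := hu.2.trans (hpq.trans hw.1)
  have hsub : Icc u w ⊆ Ioo 0 1 := Icc_subset_Ioo hu.1 (hw.2.trans hc1)
  have hvI : v ∈ Icc u w := ⟨(hu.2.trans hv.1).le, (hv.2.trans hw.1).le⟩
  obtain ⟨z, hz, hzmin⟩ := isCompact_Icc.exists_isMinOn ⟨v, hvI⟩
    fun x hx => (hT.continuousAt_deriv (hsub hx)).continuousWithinAt
  have hzv : deriv T z ≤ deriv T v := hzmin hvI
  have hzu : z ≠ u := by
    rintro rfl
    linarith
  have hzw : z ≠ w := by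
    rintro rfl
    linarith
  have hloc : IsLocalMin (deriv T) z :=
    hzmin.isLocalMin (Icc_mem_nhds (hz.1.lt_of_ne' hzu) (hz.2.lt_of_ne hzw))
  have hd3 := deriv_deriv_nonneg_of_isLocalMin hloc (hT.continuousAt_deriv (hsub hz))
  have hzc : z < c := hz.2.trans_lt hw.2
  have hneg := hS z (hsub hz) hzc.ne
  have e2 : iteratedDeriv 2 T z = deriv (deriv T) z := by
    rw [iteratedDeriv_succ, iteratedDeriv_one]
  have e3 : iteratedDeriv 3 T z = deriv (deriv (deriv T)) z := by
    rw [iteratedDeriv_succ, iteratedDeriv_succ, iteratedDeriv_one]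
  rw [schwarzian, e2, e3, hloc.deriv_eq_zero] at hneg
  have := div_nonneg hd3 (hT.deriv_nonneg ⟨(hsub hz).1, hzc⟩)
  simp only [zero_div, ne_eq, OfNat.ofNat_ne_zero, not_false_eq_true, zero_pow, mul_zero,
    sub_zero] at hneg
  linarith

/-- If `Δ < c`, then `T` maps `[0, Δ]` into `[0, T Δ]` with `T Δ < Δ`, and no orbit climbs back
towards `Δ`, against transitivity. If `Δ = c`, the critical point is fixed, against slow recurrence.
-/
lemma crit_lt_peak (hch : IsChaotic T c) : c < T c := by
  obtain ⟨h0, h1⟩ := hT.crit_mem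
  rcases lt_trichotomy (T c) c with hlt | heq | hlt
  · exfalso
    have hpos := hT.peak_pos
    have hstep : ∀ x ∈ Icc 0 (T c), T x ∈ Icc 0 (T (T c)) := fun x hx =>
      ⟨(hT.mapsTo ⟨hx.1, by linarith [hx.2]⟩).1, hT.strictMonoOn_Icc.monotoneOn
        ⟨hx.1, by linarith [hx.2]⟩ ⟨hpos.le, hlt.le⟩ hx.2⟩
    have hTT : T (T c) < T c := hT.strictMonoOn_Icc ⟨hpos.le, hlt.le⟩ ⟨h0.le, le_rfl⟩ hlt
    have hTT0 : 0 ≤ T (T c) := (hstep _ ⟨hpos.le, le_rfl⟩).1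
    obtain ⟨m, hm1, hm2⟩ := exists_between hTT
    obtain ⟨n, z, hz1, hz2⟩ := hch.transitive (Ioi m) (Iio m) isOpen_Ioi isOpen_Iio
      ⟨T c, hm2, hTT.le, le_rfl⟩ ⟨T (T c), hm1, le_rfl, hTT.le⟩
    have hzlt : m < T^[n] z := hz1.1
    have hzm : z < m := hz2.1
    have hz0 : z ∈ Icc 0 (T c) := ⟨hTT0.trans hz2.2.1, hz2.2.2⟩
    have hit : ∀ k, T^[k] z ∈ Icc 0 (T c) := fun k => by
      induction k with
      | zero => exact hz0
      | succ k ih =>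
        rw [Function.iterate_succ_apply']
        exact ⟨(hstep _ ih).1, (hstep _ ih).2.trans hTT.le⟩
    cases n with
    | zero => exact lt_asymm hzlt hzm
    | succ n =>
      rw [Function.iterate_succ_apply'] at hzlt
      linarith [(hstep _ (hit n)).2]
  · obtain ⟨k₀, lam, α, -, -, -, -, -, hk, -⟩ := hch.critical_orbit
    have := hk k₀ le_rfl
    rw [Function.iterate_fixed heq, sub_self, abs_zero] at this
    exact absurd this (not_le.2 (Real.exp_pos _))
  · exact hlt

end IsUnimodal

/-! ### Noise-invariant closed sets contain the attractor -/

namespace IsTrapping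

variable (h : IsTrapping T s g a b K)
include h

/-- A closed set which is invariant under the noisy dynamics contains a neighbourhood of every
globally attracting cycle. -/
lemma cycle_subset_interior (ha : 0 ≤ a) (hb : b ≤ 1) {S O : Set ℝ} (hS : IsClosed S)
    (hne : S.Nonempty) (hSI : S ⊆ Icc a b) (hJ : ∀ x ∈ S, Icc (T x - s x) (T x + s x) ⊆ S)
    (hO : IsGloballyAttractingCycle T O) : O ⊆ interior S := by
  obtain ⟨⟨p, -, hp, rfl⟩, hatt⟩ := hO
  obtain ⟨k, hk, hpk⟩ := hp
  have hTJ : ∀ x ∈ S, T x ∈ interior S := fun x hx => by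
    have hsx := h.size_pos x (hSI hx)
    exact interior_mono (hJ x hx)
      (by rw [interior_Icc]; exact ⟨by linarith, by linarith⟩)
  have hTS : ∀ n, ∀ x ∈ S, T^[n] x ∈ S := fun n => by
    have hm : MapsTo T S S := fun x hx => interior_subset (hTJ x hx)
    exact hm.iterate n
  have hfin : (range fun n : ℕ => T^[n] p).Finite := by
    refine ((Finset.range k).finite_toSet.image fun n => T^[n] p).subset ?_
    rintro _ ⟨n, rfl⟩
    exact ⟨n % k, by simpa using Nat.mod_lt n hk, hpk.iterate_mod_apply n⟩
  obtain ⟨x, hx⟩ := hne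
  have hsx := h.size_pos x (hSI hx)
  -- A noise interval contained in `S` has positive length, so it contains a point attracted to the
  -- cycle. Its orbit stays in the compact set `S`, which therefore meets the cycle.
  obtain ⟨y, hyS, hy⟩ : ∃ y ∈ S,
      Tendsto (fun n : ℕ => Metric.infDist (T^[n] y) (range fun n : ℕ => T^[n] p)) atTop (𝓝 0) := by
    by_contra! hcon
    have hsub := (hJ x hx)
    have h0 : volume (Icc (T x - s x) (T x + s x)) = 0 := by
      have hle : volume.restrict (Icc (T x - s x) (T x + s x)) ≤
          volume.restrict (Icc (0 : ℝ) 1) :=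
        Measure.restrict_mono_set _ ((hsub.trans hSI).trans (Icc_subset_Icc ha hb))
      have hF : ∀ᵐ z ∂volume.restrict (Icc (T x - s x) (T x + s x)), False := by
        filter_upwards [ae_restrict_mem measurableSet_Icc,
          (Measure.absolutelyContinuous_of_le hle).ae_le hatt] with z hz1 hz2
        exact hcon z (hsub hz1) hz2
      rw [ae_iff] at hF
      simpa only [not_false_eq_true, ofPred_true, Measure.restrict_apply_univ] using hF
    rw [Real.volume_Icc, ENNReal.ofReal_eq_zero] at h0
    linarith
  have hScomp : IsCompact S := isCompact_Icc.of_isClosed_subset hS hSI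
  obtain ⟨z, hz, hzmin⟩ := hScomp.exists_isMinOn ⟨x, hx⟩
    (Metric.continuous_infDist_pt (range fun n : ℕ => T^[n] p)).continuousOn
  have hz0 : Metric.infDist z (range fun n : ℕ => T^[n] p) = 0 :=
    le_antisymm (ge_of_tendsto' hy fun n => hzmin (hTS n y hyS)) Metric.infDist_nonneg
  have hzO : z ∈ range fun n : ℕ => T^[n] p :=
    (hfin.isClosed.mem_iff_infDist_zero (range_nonempty _)).2 hz0
  obtain ⟨n, rfl⟩ := hzO
  rintro _ ⟨m, rfl⟩
  -- Adding multiples of the period `k` makes the index exceed `n`, so every cycle point is the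
  -- image under `T` of a point of `S`, hence interior.
  have hnk : n ≤ n * k := Nat.le_mul_of_pos_right n hk
  have e1 : T^[m] p = T^[m + n * k + k] p := by
    rw [← hpk.iterate_mod_apply m, ← hpk.iterate_mod_apply (m + n * k + k)]
    simp
  have e2 : m + n * k + k = (m + n * k + k - 1 - n + 1) + n := by omega
  simp only
  rw [e1, e2, Function.iterate_add_apply, Function.iterate_succ_apply']
  exact hTJ _ (hTS _ _ hz)

/-- A closed set which is invariant under the noisy dynamics contains the dynamical core of a
chaotic map. -/
lemma core_subset (hT : IsUnimodal T c) (hch : IsChaotic T c) (ha : 0 < a) (hb : b ≤ 1)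
    (hexp : ∀ x ∈ Ioo 0 a, x < T x - s x) (hs : ∀ x ∈ Ioo 0 a, 0 ≤ s x)
    {S : Set ℝ} (hS : IsClosed S)
    (hne : S.Nonempty) (hSI : S ⊆ Icc a b) (hJ : ∀ x ∈ S, Icc (T x - s x) (T x + s x) ⊆ S) :
    Icc (T (T c)) (T c) ⊆ S := by
  have hcp := hT.crit_lt_peak hch
  obtain ⟨hc0, hc1⟩ := hT.crit_mem
  have hpk1 := hT.peak_lt_one
  have hI01 : Icc a b ⊆ Icc 0 1 := Icc_subset_Icc ha.le hb
  have hTTle : T (T c) ≤ T c := hT.le_peak ⟨hT.peak_pos.le, hT.peak_lt_one.le⟩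
  have hTS : MapsTo T S S := fun x hx => by
    have hsx := h.size_pos x (hSI hx)
    exact hJ x hx ⟨by linarith, by linarith⟩
  obtain ⟨x, hx, hxcore⟩ : ∃ x ∈ S, T x ∈ Icc (T (T c)) (T c) := by
    by_contra! hcon
    have hlt : ∀ x ∈ S, T x < T (T c) := fun x hx => by
      by_contra! hge
      exact hcon x hx ⟨hge, hT.le_peak (hI01 (hSI hx))⟩
    -- If `T` stays below the core on `S`, noise pushes slightly above the maximum of `T` on `S`, to
    -- some `q ∈ S` with `T q < q < T Δ`.
    obtain ⟨x₀, hx₀, hmax⟩ := (isCompact_Icc.of_isClosed_subset hS hSI).exists_isMaxOn hne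
      (h.continuousOn.mono hSI)
    have hs₀ := h.size_pos x₀ (hSI hx₀)
    obtain ⟨q, hq1, hq2⟩ := exists_between (lt_min (hlt x₀ hx₀) (lt_add_of_pos_right (T x₀) hs₀))
    have hqS : q ∈ S := hJ x₀ hx₀ ⟨by linarith, hq2.le.trans (min_le_right _ _)⟩
    have hqT : T q < q := (hmax hqS : T q ≤ T x₀).trans_lt hq1
    have hqcore : q < T (T c) := hq2.trans_le (min_le_left _ _)
    -- Left of `c`, the graph is above the diagonal at `a / 2 < q` and cannot be below it at `q`; at
    -- `c`, `c < Δ`; right of `c`, `q < Δ` gives `T q > T Δ > q`.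
    rcases lt_trichotomy q c with hqc | rfl | hqc
    · have hp : a / 2 ∈ Ioo 0 a := ⟨by linarith, by linarith⟩
      have := hT.le_of_schwarzian_neg hch.schwarzian_neg hcp hp.1
        (by linarith [hexp _ hp, hs _ hp]) (by linarith [(hSI hqS).1] : a / 2 < q) hqc
      linarith
    · linarith
    · have := hT.strictAntiOn_Icc ⟨hqc.le, by linarith⟩ ⟨hcp.le, hpk1.le⟩ (by linarith : q < T c)
      linarith
  have hsx := h.size_pos x (hSI hx)
  intro y hy
  by_contra hyS
  -- Transitivity would lead an orbit from a noise interval inside `S` out of the `T`-invariant set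
  -- `S`.
  obtain ⟨n, z, hz1, hz2⟩ := hch.transitive Sᶜ (Ioo (T x - s x) (T x + s x)) hS.isOpen_compl
    isOpen_Ioo ⟨y, hyS, hy⟩ ⟨T x, ⟨by linarith, by linarith⟩, hxcore⟩
  exact hz1.1 (hTS.iterate n (hJ x hx (Ioo_subset_Icc_self hz2.1)))

end IsTrapping

end NoisyUnimodal

end

/-! ### The main theorem -/

theorem mainTheorem1 (T : ℝ → ℝ) (c : ℝ) (s : ℝ → ℝ) (g : ℝ → ℝ → ℝ)
    (hT : NoisyUnimodal.IsUnimodal T c) (hext : NoisyUnimodal.IsExtended T c)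
    (hnoise : NoisyUnimodal.IsNoise T c s g)
    (h : NoisyUnimodal.IsPeriodic T ∨ NoisyUnimodal.IsChaotic T c) :
    ∃ μ : Measure ℝ, NoisyUnimodal.IsStationaryBV T c s g μ ∧
      (∀ ν : Measure ℝ, NoisyUnimodal.IsStationaryBV T c s g ν → ν = μ) ∧
      (∀ O : Set ℝ, NoisyUnimodal.IsGloballyAttractingCycle T O →
        ∃ V : Set ℝ, IsOpen V ∧ O ⊆ V ∧ V ⊆ μ.support) ∧
      (NoisyUnimodal.IsChaotic T c → Icc (T (T c)) (T c) ⊆ μ.support) := by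
  obtain ⟨a, K, ha0, ha1, hexp, htr⟩ := hT.exists_isTrapping hnoise
  have hg0 := hT.gap_pos
  have hg1 := hT.gap_lt_one
  set b := 1 - NoisyUnimodal.gap T c / 2 with hb
  have hb1 : b ≤ 1 := by linarith
  have hsub : Icc a b ⊆ NoisyUnimodal.stateSpace T c :=
    Icc_subset_Icc (by linarith) hb1
  have hspos : ∀ x ∈ Ioo 0 a, 0 ≤ s x := fun x hx =>
    (hnoise.size_pos x ⟨hx.1, hx.2.trans ha1⟩).le
  have hcycle : ∀ ρ : Measure ℝ, ρ ≠ 0 → ρ (Icc a b)ᶜ = 0 →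
      NoisyUnimodal.IsStationary (NoisyUnimodal.transition T s g) ρ →
      ∀ O, NoisyUnimodal.IsGloballyAttractingCycle T O → O ⊆ interior ρ.support :=
    fun ρ h0 hρ hst O hO => htr.cycle_subset_interior ha0.le hb1 Measure.isClosed_support
      (Measure.nonempty_support h0)
      (Measure.support_subset_of_isClosed isClosed_Icc (mem_ae_iff.2 hρ))
      (fun x hx => htr.Icc_subset_support hρ hst hx) hO
  have hcore : NoisyUnimodal.IsChaotic T c → ∀ ρ : Measure ℝ, ρ ≠ 0 → ρ (Icc a b)ᶜ = 0 →
      NoisyUnimodal.IsStationary (NoisyUnimodal.transition T s g) ρ →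
      Icc (T (T c)) (T c) ⊆ ρ.support :=
    fun hch ρ h0 hρ hst => htr.core_subset hT hch ha0 hb1 hexp hspos Measure.isClosed_support
      (Measure.nonempty_support h0)
      (Measure.support_subset_of_isClosed isClosed_Icc (mem_ae_iff.2 hρ))
      (fun x hx => htr.Icc_subset_support hρ hst hx)
  obtain ⟨μ, hμp, hμ, hμst⟩ := htr.exists_isStationary
  have hμ0 : μ ≠ 0 := IsProbabilityMeasure.ne_zero μ
  refine ⟨μ, ⟨hμp, hμst, ?_⟩, fun ν hν => ?_, fun O hO =>
    ⟨interior μ.support, isOpen_interior, hcycle μ hμ0 hμ hμst O hO, interior_subset⟩,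
    fun hch => hcore hch μ hμ0 hμ hμst⟩
  · obtain ⟨f, hf0, hfb, hf⟩ := htr.exists_density hμ hμst
    refine ⟨f, fun x _ => hf0 x, hfb.mono (subset_univ _), ?_⟩
    rw [NoisyUnimodal.stateSpace, ← restrict_withDensity measurableSet_Icc, ← hf]
    exact (Measure.restrict_eq_self_of_ae_mem
      (mem_of_superset (mem_ae_iff.2 hμ) hsub)).symm
  · obtain ⟨f, -, -, hf⟩ := hν.hasBVDensity
    have := hν.isProbabilityMeasure
    have hac : ν ≪ volume.restrict (NoisyUnimodal.stateSpace T c) := by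
      rw [hf]
      exact withDensity_absolutelyContinuous _ _
    have hνI : ν (Icc a b)ᶜ = 0 := hT.measure_compl_trapping hext hnoise ha1 hexp htr
      (hac.trans Measure.absolutelyContinuous_restrict)
      (hac (mem_ae_iff.1 (ae_restrict_mem measurableSet_Icc))) hν.isStationary
    refine htr.eq_of_isStationary hνI hμ hν.isStationary hμst
      fun ρ₁ ρ₂ _ _ h₁ h₂ hρ₁ hρ₂ hst₁ hst₂ => ?_
    -- The common open set: the intersection of the interiors of the supports, which contains a
    -- cycle point, or the interior of the core, nonempty because `c < Δ` forces `T Δ < Δ`.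
    rcases h with ⟨O, hO⟩ | hch
    · obtain ⟨p, -, -, hp⟩ := hO.1
      have hpO : p ∈ O := hp ▸ ⟨0, rfl⟩
      exact ⟨interior ρ₁.support ∩ interior ρ₂.support, isOpen_interior.inter isOpen_interior,
        ⟨p, hcycle ρ₁ h₁ hρ₁ hst₁ O hO hpO, hcycle ρ₂ h₂ hρ₂ hst₂ O hO hpO⟩,
        inter_subset_left.trans interior_subset, inter_subset_right.trans interior_subset⟩
    · have hlt : T (T c) < T c :=
        hT.strictAntiOn_Icc ⟨le_rfl, hT.crit_mem.2.le⟩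
          ⟨(hT.crit_lt_peak hch).le, hT.peak_lt_one.le⟩ (hT.crit_lt_peak hch)
      exact ⟨Ioo (T (T c)) (T c), isOpen_Ioo, nonempty_Ioo.2 hlt,
        Ioo_subset_Icc_self.trans (hcore hch ρ₁ h₁ hρ₁ hst₁),
        Ioo_subset_Icc_self.trans (hcore hch ρ₂ h₂ hρ₂ hst₂)⟩
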